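/- Let $G$ be an abelian group, let $m, n$ be integers with $n \ge 2$ and $m \ge (\log n)^2$, where $\log$ is the natural logarithm, let $Y \subset G$ be a set with $|Y| = n$, and let $0 < \varepsilon < \frac14$. Write $S+T = \{s+t : s \in S,\ t \in T\}$ for $S, T \subset G$. Then there is a family $\mathcal{A}$ of pairs $(A,B)$ with $A \subset Y+Y$ and $B \subset Y$, of size $$|\mathcal{A}| \le \exp\Big(2^{16}\,\frac{1}{\varepsilon^{2}}\,\sqrt{m}\,(\log n)^{3/2}\Big),$$ such that the following two properties hold. (i) For every pair of sets $J \subset Y$ and $I \subset Y+Y$ with $J+J \subset I$ and $|I| \le m$, there is $(A,B) \in \mathcal{A}$ such that $A \subset I$ and $J \subset B$. (ii) For every $(A,B) \in \mathcal{A}$ we have $|A| \le m$, and either $|B| \le \frac{m}{\log n}$ or there are at most $\varepsilon^2 |B|^2$ pairs $(b_1,b_2) \in B \times B$ such that $b_1+b_2 \notin A$. -/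

import Mathlib

open scoped Pointwise

/-! This is a container algorithm. A state is a pair (A, B) with A known to lie in I and J known to
lie in B. If (A, B) is not yet a container, the set H of elements of B with at least ε²|B|/2 missing
sums is itself of size at least ε²|B|/2. Either J meets H in fewer than s elements, and recording J
∩ H lets B shrink; or J contains an s-element set S ⊆ H, and A absorbs S + b for those b ∈ J that
give many new sums (`HasContainers.of_saturated`). When this stops, either A has grown by δ|B|, or
double counting shrinks B by the factor 1 - δ, where δ = ε²/8 (`card_filter_newSums_le`).

Each outcome lowers `roundPotential` by one, so O(log n / ε²) rounds suffice, each costing at most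
n^(3s) choices. Absorptions number at most m/(δs) over all rounds together, because |A| ≤ m. Taking
s ≈ √(m / log n) balances the two costs. -/

section Containers

variable {G : Type*} [AddCommGroup G] [DecidableEq G]

/-- The ordered pairs of elements of `B` whose sum is not in `A`. -/
def missingPairs (A B : Finset G) : Finset (G × G) :=
  (B ×ˢ B).filter (fun b => b.1 + b.2 ∉ A)

/-- `(A, B)` is a container: `A` is small and `B` is small or has almost all its sums in `A`. -/
def IsContainer (m : ℕ) (M ε : ℝ) (Y A B : Finset G) : Prop :=
  A ⊆ Y + Y ∧ B ⊆ Y ∧ A.card ≤ m ∧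
    ((B.card : ℝ) ≤ M ∨ ((missingPairs A B).card : ℝ) ≤ ε ^ 2 * (B.card : ℝ) ^ 2)

/-- There are at most `N` containers covering every pair `(I, J)` with `A ⊆ I`, `S ⊆ J ⊆ B`,
`J + J ⊆ I` and `|I| ≤ m`. -/
def HasContainers (m : ℕ) (M ε : ℝ) (Y A B S : Finset G) (N : ℝ) : Prop :=
  ∃ 𝒜 : Finset (Finset G × Finset G),
    (∀ p ∈ 𝒜, IsContainer m M ε Y p.1 p.2) ∧ (𝒜.card : ℝ) ≤ N ∧
    ∀ I J : Finset G, A ⊆ I → J ⊆ B → S ⊆ J → J + J ⊆ I → I.card ≤ m →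
      ∃ p ∈ 𝒜, p.1 ⊆ I ∧ J ⊆ p.2

/-- The elements `a` of `S` for which the sum `a + b` is not in `A`. -/
def newSums (A S : Finset G) (b : G) : Finset G := S.filter (fun a => a + b ∉ A)

variable {m : ℕ} {M ε : ℝ} {Y A B S : Finset G} {N : ℝ}

/-! ### Combining families of containers -/

lemma HasContainers.mono {N' : ℝ} (h : HasContainers m M ε Y A B S N) (hN : N ≤ N') :
    HasContainers m M ε Y A B S N' := by
  obtain ⟨F, h1, h2, h3⟩ := h
  exact ⟨F, h1, h2.trans hN, h3⟩

lemma HasContainers.of_lt_card (hA : m < A.card) (hN : 0 ≤ N) :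
    HasContainers m M ε Y A B S N := by
  refine ⟨∅, by simp, by simpa using hN, fun I J hAI _ _ _ hI => ?_⟩
  have := Finset.card_le_card hAI
  omega

lemma HasContainers.of_isContainer (h : IsContainer m M ε Y A B) (hN : 1 ≤ N) :
    HasContainers m M ε Y A B S N :=
  ⟨{(A, B)}, by simpa using h, by simpa using hN, fun I J hAI hJ _ _ _ => ⟨(A, B), by simp, hAI, hJ⟩⟩

/-- The branching step of the algorithm: the families of the branches can be pooled as soon as every
pair (I, J) fits at least one branch. -/
lemma HasContainers.biUnion {ι : Type*} (T : Finset ι) (A' B' S' : ι → Finset G) (N' : ι → ℝ)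
    (h : ∀ i ∈ T, HasContainers m M ε Y (A' i) (B' i) (S' i) (N' i))
    (hcov : ∀ I J : Finset G, A ⊆ I → J ⊆ B → S ⊆ J → J + J ⊆ I → I.card ≤ m →
      ∃ i ∈ T, A' i ⊆ I ∧ J ⊆ B' i ∧ S' i ⊆ J) :
    HasContainers m M ε Y A B S (∑ i ∈ T, N' i) := by
  classical
  choose! F h1 h2 h3 using h
  refine ⟨T.biUnion F, ?_, ?_, ?_⟩
  · intro p hp
    obtain ⟨i, hi, hp⟩ := Finset.mem_biUnion.1 hp
    exact h1 i hi p hp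
  · calc ((T.biUnion F).card : ℝ) ≤ ((∑ i ∈ T, (F i).card : ℕ) : ℝ) := by
          exact_mod_cast Finset.card_biUnion_le
      _ = ∑ i ∈ T, ((F i).card : ℝ) := by push_cast; rfl
      _ ≤ _ := Finset.sum_le_sum h2
  · intro I J hA hB hS hJ hI
    obtain ⟨i, hi, ha, hb, hs⟩ := hcov I J hA hB hS hJ hI
    obtain ⟨p, hp, h⟩ := h3 i hi I J ha hb hs hJ hI
    exact ⟨p, Finset.mem_biUnion.2 ⟨i, hi, hp⟩, h⟩

omit [AddCommGroup G] in
/-- A set of `n ≥ 2` elements has at most `n ^ (2 s)` subsets of size at most `s`. -/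
lemma card_subsets_card_le (hn : 2 ≤ Y.card) (s : ℕ) :
    (Y.powerset.filter (fun S => S.card ≤ s)).card ≤ Y.card ^ (2 * s) := by
  classical
  let f : (Fin s → Option Y) → Finset G := fun g =>
    Finset.univ.biUnion (fun i => ((g i).map (fun y : Y => (y : G))).toFinset)
  have hsub : Y.powerset.filter (fun S => S.card ≤ s) ⊆ Finset.univ.image f := by
    intro S hS
    obtain ⟨hSY, hs⟩ := Finset.mem_filter.1 hS
    rw [Finset.mem_powerset] at hSY
    let e := S.equivFin
    refine Finset.mem_image.2 ⟨fun i => if h : (i : ℕ) < S.card then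
      some ⟨(e.symm ⟨i, h⟩ : G), hSY (e.symm ⟨i, h⟩).2⟩ else none, Finset.mem_univ _, ?_⟩
    ext x
    simp only [f, Finset.mem_biUnion, Finset.mem_univ, true_and, Option.mem_toFinset]
    constructor
    · rintro ⟨i, hi⟩
      by_cases h : (i : ℕ) < S.card
      · simp [h] at hi
        rw [← hi]
        exact (e.symm ⟨i, h⟩).2
      · simp [h] at hi
    · intro hx
      refine ⟨⟨e ⟨x, hx⟩, (e ⟨x, hx⟩).2.trans_le hs⟩, ?_⟩
      simp
  have hcard : Fintype.card (Fin s → Option Y) = (Y.card + 1) ^ s := by simp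
  calc _ ≤ (Finset.univ.image f).card := Finset.card_le_card hsub
    _ ≤ (Y.card + 1) ^ s := by
      rw [← hcard]; exact Finset.card_image_le
    _ ≤ (Y.card ^ 2) ^ s := by gcongr; nlinarith
    _ = _ := by rw [pow_mul]

/-! ### Saturating A by translates of S -/

lemma card_union_add_image (A S : Finset G) (b : G) :
    (A ∪ S.image (· + b)).card = A.card + (newSums A S b).card := by
  have : A ∪ S.image (· + b) = A ∪ (newSums A S b).image (· + b) := by
    ext x
    simp only [newSums, Finset.mem_union, Finset.mem_image, Finset.mem_filter]
    constructor
    · rintro (h | ⟨a, ha, rfl⟩)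
      · exact Or.inl h
      · by_cases h : a + b ∈ A
        · exact Or.inl h
        · exact Or.inr ⟨a, ⟨ha, h⟩, rfl⟩
    · rintro (h | ⟨a, ha, rfl⟩)
      · exact Or.inl h
      · exact Or.inr ⟨a, ha.1, rfl⟩
  rw [this, Finset.card_union_of_disjoint, Finset.card_image_of_injective _ (add_left_injective b)]
  rw [Finset.disjoint_right]
  intro x hx
  obtain ⟨a, ha, rfl⟩ := Finset.mem_image.1 hx
  exact (Finset.mem_filter.1 ha).2

/-- Enlarging `A` by the sumsets `S + b` with `b ∈ J` that have many new elements, until no element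
of `J` has that property. -/
lemma HasContainers.of_saturated (hn : 2 ≤ Y.card) {τ K : ℝ} (hτ : 0 < τ) (hK : 0 ≤ K)
    {A₀ : Finset G} (hB : B ⊆ Y) (hS : S ⊆ Y)
    (hleaf : ∀ A, A₀ ⊆ A → A ⊆ Y + Y → A.card ≤ m →
      HasContainers m M ε Y A (B.filter (fun b => ((newSums A S b).card : ℝ) < τ)) ∅
        (K * Real.exp (2 * Real.log Y.card * ((m - A.card) / τ))))
    (A : Finset G) (hA₀ : A₀ ⊆ A) (hA : A ⊆ Y + Y) :
    HasContainers m M ε Y A B S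
      (2 * K * Real.exp (2 * Real.log Y.card * ((m - A.card) / τ))) := by
  classical
  induction hk : m + 1 - A.card using Nat.strong_induction_on generalizing A with
  | _ k ih =>
  by_cases hAm : m < A.card
  · exact of_lt_card hAm (by positivity)
  push Not at hAm
  set L := Real.log Y.card with hL
  have hn' : (2 : ℝ) ≤ Y.card := by exact_mod_cast hn
  have hLpos : 0 < L := Real.log_pos (by linarith)
  have hexpL : Real.exp L = Y.card := Real.exp_log (by linarith)
  set T : Finset G := B.filter (fun b => τ ≤ ((newSums A S b).card : ℝ)) with hT
  -- A gains at least τ elements, so the bound drops by n⁻²; this pays for the at most n choices of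
  -- b and for the factor 2.
  have hbr : ∀ b ∈ T, HasContainers m M ε Y (A ∪ S.image (· + b)) B S
      (2 * K * (Real.exp (2 * L * ((m - A.card) / τ)) * Real.exp (-(2 * L)))) := by
    intro b hb
    obtain ⟨hbB, hbτ⟩ := Finset.mem_filter.1 hb
    have hc := card_union_add_image A S b
    have hpos : 0 < (newSums A S b).card := by
      have := hτ.trans_le hbτ
      exact_mod_cast this
    refine (ih _ (by omega) (A ∪ S.image (· + b)) (hA₀.trans Finset.subset_union_left) ?_ rfl).mono ?_
    · refine Finset.union_subset hA fun x hx => ?_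
      obtain ⟨a, ha, rfl⟩ := Finset.mem_image.1 hx
      exact Finset.add_mem_add (hS ha) (hB hbB)
    · rw [← Real.exp_add, hc]
      have h : ((m : ℝ) - ((A.card + (newSums A S b).card : ℕ) : ℝ)) / τ ≤ (m - A.card) / τ - 1 := by
        rw [div_le_iff₀ hτ, sub_mul, div_mul_cancel₀ _ hτ.ne']
        push_cast
        linarith
      gcongr
      nlinarith
  -- The index `none` is the saturated branch; `some b` absorbs S + b.
  have key := HasContainers.biUnion (m := m) (M := M) (ε := ε) (Y := Y) (A := A) (B := B) (S := S)
    (Finset.insertNone T)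
    (fun o => o.elim A (fun b => A ∪ S.image (· + b)))
    (fun o => o.elim (B.filter (fun b => ((newSums A S b).card : ℝ) < τ)) (fun _ => B))
    (fun o => o.elim ∅ (fun _ => S))
    (fun o => o.elim (K * Real.exp (2 * L * ((m - A.card) / τ)))
      (fun _ => 2 * K * (Real.exp (2 * L * ((m - A.card) / τ)) * Real.exp (-(2 * L))))) ?_ ?_
  · refine key.mono ?_
    rw [Finset.sum_insertNone]
    simp only [Option.elim, Finset.sum_const, nsmul_eq_mul]
    have hTn : (T.card : ℝ) ≤ Y.card := by
      exact_mod_cast Finset.card_le_card ((Finset.filter_subset _ _).trans hB)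
    have h2 : (T.card : ℝ) * (2 * Real.exp (-(2 * L))) ≤ 1 := by
      rw [Real.exp_neg, two_mul L, Real.exp_add, hexpL]
      have : (Y.card : ℝ) * (2 * ((Y.card : ℝ) * Y.card)⁻¹) = 2 / Y.card := by
        field_simp
      calc (T.card : ℝ) * (2 * ((Y.card : ℝ) * Y.card)⁻¹)
          ≤ (Y.card : ℝ) * (2 * ((Y.card : ℝ) * Y.card)⁻¹) := by gcongr
        _ = 2 / Y.card := this
        _ ≤ 1 := by rw [div_le_one (by linarith)]; exact hn'
    set E := Real.exp (2 * L * ((m - A.card) / τ)) with hE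
    have hE0 : 0 ≤ K * E := by positivity
    have := mul_le_mul_of_nonneg_left h2 hE0
    linarith
  · intro o ho
    cases o with
    | none => exact hleaf A hA₀ hA hAm
    | some b => exact hbr b (by simpa using ho)
  · intro I J hAI hJB hSJ hJ hI
    by_cases h : ∃ b ∈ J, τ ≤ ((newSums A S b).card : ℝ)
    · obtain ⟨b, hbJ, hb⟩ := h
      refine ⟨some b, by simpa [hT] using ⟨hJB hbJ, hb⟩, ?_, hJB, hSJ⟩
      refine Finset.union_subset hAI fun x hx => ?_
      obtain ⟨a, ha, rfl⟩ := Finset.mem_image.1 hx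
      exact hJ (Finset.add_mem_add (hSJ ha) hbJ)
    · push Not at h
      exact ⟨none, by simp, hAI, fun b hb => Finset.mem_filter.2 ⟨hJB hb, h b hb⟩, by simp⟩

/-! ### Double counting missing sums -/

/-- A set with many missing pairs has many elements in many missing pairs. -/
lemma le_card_filter_newSums (hbad : ε ^ 2 * (B.card : ℝ) ^ 2 < (missingPairs A B).card) :
    ε ^ 2 / 2 * B.card ≤
      (B.filter (fun a => ε ^ 2 / 2 * B.card ≤ ((newSums A B a).card : ℝ))).card := by
  have hB : 0 < (B.card : ℝ) := by
    rcases Finset.eq_empty_or_nonempty B with rfl | h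
    · simp [missingPairs] at hbad
    · exact_mod_cast h.card_pos
  have hsum : ((missingPairs A B).card : ℝ) = ∑ a ∈ B, ((newSums A B a).card : ℝ) := by
    rw [missingPairs, Finset.card_filter, Finset.sum_product_right]
    simp only [newSums, Finset.card_filter]
    push_cast
    rfl
  have hle : ∑ a ∈ B, ((newSums A B a).card : ℝ) ≤
      ∑ a ∈ B, ((if ε ^ 2 / 2 * B.card ≤ ((newSums A B a).card : ℝ) then (B.card : ℝ) else 0)
        + ε ^ 2 / 2 * B.card) := by
    refine Finset.sum_le_sum fun a _ => ?_
    have h1 : ((newSums A B a).card : ℝ) ≤ B.card := by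
      exact_mod_cast Finset.card_le_card (Finset.filter_subset _ _)
    have h2 : 0 ≤ ε ^ 2 / 2 * B.card := by positivity
    split_ifs with h
    · linarith
    · linarith
  rw [Finset.sum_add_distrib, ← Finset.sum_filter, Finset.sum_const, Finset.sum_const,
    nsmul_eq_mul, nsmul_eq_mul] at hle
  set h := ((B.filter (fun a => ε ^ 2 / 2 * B.card ≤ ((newSums A B a).card : ℝ))).card : ℝ)
  have : (ε ^ 2 / 2 * B.card) * B.card ≤ h * B.card := by nlinarith
  exact le_of_mul_le_mul_right this hB

/-- If every element of `S` has many sums with `B` outside `A` and `A'` is not much larger than `A`,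
then a positive proportion of `B` has many sums with `S` outside `A'`. -/
lemma card_filter_newSums_le {A' : Finset G} (hAA : A ⊆ A') (hS0 : S.Nonempty)
    (hS : ∀ a ∈ S, ε ^ 2 / 2 * B.card ≤ ((newSums A B a).card : ℝ))
    (hA' : (A'.card : ℝ) ≤ A.card + ε ^ 2 / 8 * B.card) :
    ((B.filter (fun b => ((newSums A' S b).card : ℝ) < ε ^ 2 / 8 * S.card)).card : ℝ) ≤
      (1 - ε ^ 2 / 8) * B.card := by
  have hs : 0 < (S.card : ℝ) := by exact_mod_cast hS0.card_pos
  -- Passing to A' destroys at most ε²|B|/8 missing sums of a, and 1/2 - 1/8 = 3/8.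
  have hdeg : ∀ a ∈ S, 3 * ε ^ 2 / 8 * B.card ≤ ((newSums A' B a).card : ℝ) := by
    intro a ha
    have h1 : newSums A B a ⊆ newSums A' B a ∪ (A' \ A).image (· - a) := by
      intro b hb
      obtain ⟨hbB, hb⟩ := Finset.mem_filter.1 hb
      by_cases h : b + a ∈ A'
      · exact Finset.mem_union_right _ (Finset.mem_image.2 ⟨b + a, Finset.mem_sdiff.2 ⟨h, hb⟩, by simp⟩)
      · exact Finset.mem_union_left _ (Finset.mem_filter.2 ⟨hbB, h⟩)
    have h2 : (newSums A B a).card ≤ (newSums A' B a).card + (A' \ A).card :=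
      (Finset.card_le_card h1).trans
        ((Finset.card_union_le _ _).trans (Nat.add_le_add_left Finset.card_image_le _))
    have h3 : (A' \ A).card + A.card = A'.card := Finset.card_sdiff_add_card_eq_card hAA
    have h2' : ((newSums A B a).card : ℝ) ≤ (newSums A' B a).card + (A' \ A).card := by
      exact_mod_cast h2
    have h3' : ((A' \ A).card : ℝ) + A.card = A'.card := by exact_mod_cast h3
    have := hS a ha
    linarith
  have hswap : ∑ a ∈ S, ((newSums A' B a).card : ℝ) = ∑ b ∈ B, ((newSums A' S b).card : ℝ) := by
    simp only [newSums, Finset.card_filter]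
    push_cast
    rw [Finset.sum_comm]
    simp only [add_comm]
  have hlow : (S.card : ℝ) * (3 * ε ^ 2 / 8 * B.card) ≤ ∑ a ∈ S, ((newSums A' B a).card : ℝ) := by
    have := Finset.sum_le_sum hdeg
    rwa [Finset.sum_const, nsmul_eq_mul] at this
  have hup : ∑ b ∈ B, ((newSums A' S b).card : ℝ) ≤
      ∑ b ∈ B, ((S.card : ℝ) + ε ^ 2 / 8 * S.card -
        (if ((newSums A' S b).card : ℝ) < ε ^ 2 / 8 * S.card then (S.card : ℝ) else 0)) := by
    refine Finset.sum_le_sum fun b _ => ?_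
    have h1 : ((newSums A' S b).card : ℝ) ≤ S.card := by
      exact_mod_cast Finset.card_le_card (Finset.filter_subset _ _)
    have h2 : 0 ≤ ε ^ 2 / 8 * S.card := by positivity
    split_ifs with h <;> linarith
  rw [Finset.sum_sub_distrib, ← Finset.sum_filter, Finset.sum_const, Finset.sum_const,
    nsmul_eq_mul, nsmul_eq_mul] at hup
  set t := ((B.filter (fun b => ((newSums A' S b).card : ℝ) < ε ^ 2 / 8 * S.card)).card : ℝ)
  have hB : 0 ≤ ε ^ 2 * (B.card : ℝ) := by positivity
  refine le_of_mul_le_mul_right ?_ hs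
  nlinarith

/-! ### The potential and the induction on rounds -/

/-- Potential bounding the number of rounds from the state `(A, B)`. -/
noncomputable def roundPotential (m : ℕ) (M δ : ℝ) (A B : Finset G) : ℝ :=
  ((m - A.card) / M + Real.log B.card) / δ

omit [AddCommGroup G] [DecidableEq G] in
lemma roundPotential_le_sub_one_of_card_add_le {δ : ℝ} (hM : 0 < M) (hδ : 0 < δ)
    {A' B' : Finset G} (hB : B' ⊆ B) (hA : (A.card : ℝ) + δ * M ≤ A'.card) :
    roundPotential m M δ A' B' ≤ roundPotential m M δ A B - 1 := by
  have hlog : Real.log B'.card ≤ Real.log B.card := by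
    rcases Finset.eq_empty_or_nonempty B' with rfl | h
    · simpa using Real.log_natCast_nonneg _
    · exact Real.log_le_log (by exact_mod_cast h.card_pos) (by exact_mod_cast Finset.card_le_card hB)
  have h : ((m : ℝ) - A'.card) / M ≤ (m - A.card) / M - δ := by
    rw [div_le_iff₀ hM, sub_mul, div_mul_cancel₀ _ hM.ne']
    linarith
  unfold roundPotential
  rw [div_le_iff₀ hδ, sub_mul, div_mul_cancel₀ _ hδ.ne']
  linarith

omit [AddCommGroup G] [DecidableEq G] in
lemma roundPotential_le_sub_one_of_card_le {δ : ℝ} (hM : 0 < M) (hδ : 0 < δ)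
    (hδ1 : δ ≤ 1 / 2) (hB2 : 2 ≤ (B.card : ℝ)) {A' B' : Finset G} (hA : A ⊆ A')
    (hB : (B'.card : ℝ) ≤ (1 - δ) * B.card) :
    roundPotential m M δ A' B' ≤ roundPotential m M δ A B - 1 := by
  -- Needed when B' is empty, where `Real.log 0 = 0` must still be at most log((1 - δ)|B|).
  have h1 : 1 ≤ (1 - δ) * (B.card : ℝ) := by nlinarith
  have hlog : Real.log B'.card ≤ Real.log B.card - δ := by
    have h2 : Real.log B'.card ≤ Real.log ((1 - δ) * B.card) := by
      rcases Finset.eq_empty_or_nonempty B' with rfl | h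
      · simpa using Real.log_nonneg h1
      · exact Real.log_le_log (by exact_mod_cast h.card_pos) hB
    rw [Real.log_mul (by linarith) (by linarith)] at h2
    have := Real.log_le_sub_one_of_pos (show 0 < 1 - δ by linarith)
    linarith
  have h : ((m : ℝ) - A'.card) / M ≤ (m - A.card) / M := by
    have : (A.card : ℝ) ≤ A'.card := by exact_mod_cast Finset.card_le_card hA
    gcongr
  unfold roundPotential
  rw [div_le_iff₀ hδ, sub_mul, div_mul_cancel₀ _ hδ.ne']
  linarith

/-- The number of containers needed from the state `(A, B)`, by induction on the number of rounds. -/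
lemma hasContainers_of_roundPotential_lt (hn : 2 ≤ Y.card) (hε0 : 0 < ε) (hε1 : ε < 1 / 4)
    (hM : 2 ≤ M) {s : ℕ} (hs : 0 < s) (hsM : (s : ℝ) ≤ ε ^ 2 / 4 * M) (k : ℕ)
    (A B : Finset G) (hA : A ⊆ Y + Y) (hB : B ⊆ Y)
    (hk : roundPotential m M (ε ^ 2 / 8) A B < k) :
    HasContainers m M ε Y A B ∅
      (Real.exp (3 * s * Real.log Y.card * roundPotential m M (ε ^ 2 / 8) A B) *
        Real.exp (2 * Real.log Y.card * ((m - A.card) / (ε ^ 2 / 8 * s)))) := by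
  classical
  induction k generalizing A B with
  | zero =>
    -- A negative potential forces |A| > m, so no I is left to cover.
    refine HasContainers.of_lt_card ?_ (by positivity)
    by_contra! h
    have h' : (0 : ℝ) ≤ m - A.card := by
      rw [sub_nonneg]; exact_mod_cast h
    have : 0 ≤ roundPotential m M (ε ^ 2 / 8) A B := by
      have := Real.log_natCast_nonneg B.card
      unfold roundPotential
      positivity
    norm_num at hk
    linarith
  | succ k ih =>
  by_cases hAm : m < A.card
  · exact HasContainers.of_lt_card hAm (by positivity)
  push Not at hAm
  set L := Real.log Y.card with hL
  have hn' : (2 : ℝ) ≤ Y.card := by exact_mod_cast hn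
  have hLpos : 0 < L := Real.log_pos (by linarith)
  have hexpL : Real.exp L = Y.card := Real.exp_log (by linarith)
  set δ := ε ^ 2 / 8 with hδ
  have hδ0 : 0 < δ := by positivity
  have hδ1 : δ ≤ 1 / 2 := by nlinarith
  have hs1 : (1 : ℝ) ≤ s := by exact_mod_cast hs
  set τ := δ * s with hτ
  have hτ0 : 0 < τ := by positivity
  have hAm' : (0 : ℝ) ≤ m - A.card := by
    rw [sub_nonneg]; exact_mod_cast hAm
  by_cases hcont : IsContainer m M ε Y A B
  · refine HasContainers.of_isContainer hcont ?_
    have : 0 ≤ roundPotential m M δ A B := by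
      have := Real.log_natCast_nonneg B.card
      unfold roundPotential
      positivity
    exact one_le_mul_of_one_le_of_one_le (Real.one_le_exp (by positivity))
      (Real.one_le_exp (by positivity))
  have hnot : ¬ ((B.card : ℝ) ≤ M ∨ ((missingPairs A B).card : ℝ) ≤ ε ^ 2 * (B.card : ℝ) ^ 2) :=
    fun h => hcont ⟨hA, hB, hAm, h⟩
  push Not at hnot
  obtain ⟨hBM, hbad⟩ := hnot
  set H := B.filter (fun a => ε ^ 2 / 2 * B.card ≤ ((newSums A B a).card : ℝ)) with hH
  have hHcard : ε ^ 2 / 2 * B.card ≤ H.card := le_card_filter_newSums hbad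
  have hHB : H ⊆ B := Finset.filter_subset _ _
  set P := roundPotential m M δ A B with hP
  set E := Real.exp (2 * L * ((m - A.card) / τ)) with hE
  have hstep : ∀ A' B' : Finset G, A' ⊆ Y + Y → B' ⊆ Y → roundPotential m M δ A' B' ≤ P - 1 →
      HasContainers m M ε Y A' B' ∅ (Real.exp (3 * s * L * (P - 1)) *
        Real.exp (2 * L * ((m - A'.card) / τ))) := by
    intro A' B' hA' hB' h
    refine (ih A' B' hA' hB' ?_).mono ?_
    · push_cast at hk
      linarith
    · gcongr
  -- An S of size s is a subset of J ∩ H; a smaller S stands for J ∩ H itself.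
  have key := HasContainers.biUnion (m := m) (M := M) (ε := ε) (Y := Y) (A := A) (B := B) (S := ∅)
    (H.powerset.filter (fun S => S.card ≤ s))
    (fun _ => A)
    (fun S => if S.card = s then B else (B \ H) ∪ S)
    (fun S => if S.card = s then S else ∅)
    (fun _ => 2 * Real.exp (3 * s * L * (P - 1)) * E) ?_ ?_
  · refine key.mono ?_
    rw [Finset.sum_const, nsmul_eq_mul]
    have hc : ((H.powerset.filter (fun S => S.card ≤ s)).card : ℝ) ≤ Real.exp (2 * s * L) := by
      have h1 : (H.powerset.filter (fun S => S.card ≤ s)).card ≤ Y.card ^ (2 * s) :=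
        (Finset.card_le_card (Finset.filter_subset_filter _
          (Finset.powerset_mono.2 (hHB.trans hB)))).trans (card_subsets_card_le hn s)
      have h2 : Real.exp (2 * s * L) = (Y.card : ℝ) ^ (2 * s) := by
        rw [← hexpL, ← Real.exp_nat_mul]
        push_cast
        ring_nf
      rw [h2]
      exact_mod_cast h1
    have h2 : (2 : ℝ) ≤ Real.exp (s * L) := by
      refine hn'.trans ?_
      rw [← hexpL]
      exact Real.exp_le_exp.2 (by nlinarith)
    calc ((H.powerset.filter (fun S => S.card ≤ s)).card : ℝ) *
          (2 * Real.exp (3 * s * L * (P - 1)) * E)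
        ≤ Real.exp (2 * s * L) * (Real.exp (s * L) * Real.exp (3 * s * L * (P - 1)) * E) := by
          gcongr
      _ = Real.exp (3 * s * L * P) * E := by
          rw [← mul_assoc, ← mul_assoc, ← Real.exp_add, ← Real.exp_add]
          ring_nf
  · intro S hS
    obtain ⟨hSH, hSs⟩ := Finset.mem_filter.1 hS
    rw [Finset.mem_powerset] at hSH
    have hSB := hSH.trans hHB
    by_cases hc : S.card = s
    · simp only [hc, if_true]
      refine HasContainers.of_saturated hn hτ0 (Real.exp_pos _).le (A₀ := A) hB (hSB.trans hB)
        (fun A' hAA' hA' _ => hstep A' _ hA' ((Finset.filter_subset _ _).trans hB) ?_) A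
        Finset.Subset.rfl hA
      by_cases hgrow : (A'.card : ℝ) ≤ A.card + δ * B.card
      · refine roundPotential_le_sub_one_of_card_le (by linarith) hδ0 hδ1 (by linarith) hAA' ?_
        rw [hτ, ← hc]
        exact card_filter_newSums_le hAA' (Finset.card_pos.1 (by omega))
          (fun a ha => (Finset.mem_filter.1 (hSH ha)).2) hgrow
      · push Not at hgrow
        refine roundPotential_le_sub_one_of_card_add_le (by linarith) hδ0
          (Finset.filter_subset _ _) ?_
        nlinarith
    · simp only [hc, if_false]
      have hsub : B \ H ∪ S ⊆ Y :=
        Finset.union_subset (Finset.sdiff_subset.trans hB) (hSB.trans hB)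
      refine (hstep A _ hA hsub ?_).mono ?_
      -- B loses H, at least ε²|B|/2 elements, and regains at most s ≤ ε²|B|/4.
      · refine roundPotential_le_sub_one_of_card_le (by linarith) hδ0 hδ1 (by linarith)
          Finset.Subset.rfl ?_
        have h1 : ((B \ H ∪ S).card : ℝ) ≤ (B \ H).card + S.card := by
          exact_mod_cast Finset.card_union_le _ _
        have h2 : ((B \ H).card : ℝ) + H.card = B.card := by
          exact_mod_cast Finset.card_sdiff_add_card_eq_card hHB
        have h3 : (S.card : ℝ) ≤ s := by exact_mod_cast hSs
        have h4 : ε ^ 2 / 4 * M ≤ ε ^ 2 / 4 * B.card := by gcongr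
        have h5 : 0 ≤ ε ^ 2 * (B.card : ℝ) := by positivity
        rw [hδ]
        linarith
      · have : 0 < Real.exp (3 * s * L * (P - 1)) * E := by positivity
        linarith
  · intro I J hAI hJB _ _ _
    by_cases h : s ≤ (J ∩ H).card
    · obtain ⟨S, hSJ, hSc⟩ := Finset.exists_subset_card_eq h
      refine ⟨S, Finset.mem_filter.2 ⟨Finset.mem_powerset.2
        (hSJ.trans Finset.inter_subset_right), hSc.le⟩, hAI, ?_, ?_⟩
      · simpa [hSc] using hJB
      · simpa [hSc] using hSJ.trans Finset.inter_subset_left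
    · push Not at h
      refine ⟨J ∩ H, Finset.mem_filter.2 ⟨Finset.mem_powerset.2 Finset.inter_subset_right, h.le⟩,
        hAI, ?_, ?_⟩
      · simp only [h.ne, if_false]
        intro x hx
        by_cases hxH : x ∈ H
        · exact Finset.mem_union_right _ (Finset.mem_inter.2 ⟨hx, hxH⟩)
        · exact Finset.mem_union_left _ (Finset.mem_sdiff.2 ⟨hJB hx, hxH⟩)
      · simp [h.ne]

/-! ### Choice of parameters -/

/-- The pairs `(J + J, J)` form a family of containers. -/
lemma hasContainers_sumsets (hn : 2 ≤ Y.card) :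
    HasContainers m M ε Y ∅ Y ∅ (Real.exp (2 * m * Real.log Y.card)) := by
  classical
  refine ⟨((Y.powerset.filter (fun J => J.card ≤ m)).filter
    (fun J => (J + J).card ≤ m)).image (fun J => (J + J, J)), ?_, ?_, ?_⟩
  · intro p hp
    obtain ⟨J, hJ, rfl⟩ := Finset.mem_image.1 hp
    simp only [Finset.mem_filter, Finset.mem_powerset] at hJ
    refine ⟨Finset.add_subset_add hJ.1.1 hJ.1.1, hJ.1.1, hJ.2, Or.inr ?_⟩
    have : missingPairs (J + J) J = ∅ := by
      refine Finset.filter_eq_empty_iff.2 fun b hb => ?_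
      rw [Finset.mem_product] at hb
      simpa using Finset.add_mem_add hb.1 hb.2
    rw [this]
    simp only [Finset.card_empty, Nat.cast_zero]
    positivity
  · have h1 := (Finset.card_image_le (f := fun J : Finset G => (J + J, J))
      (s := (Y.powerset.filter (fun J => J.card ≤ m)).filter (fun J => (J + J).card ≤ m))).trans
      ((Finset.card_filter_le _ _).trans (card_subsets_card_le hn m))
    have h2 : Real.exp (2 * m * Real.log Y.card) = (Y.card : ℝ) ^ (2 * m) := by
      have : Real.exp (Real.log Y.card) = Y.card := Real.exp_log (by exact_mod_cast (by omega))
      conv_rhs => rw [← this, ← Real.exp_nat_mul]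
      push_cast
      ring_nf
    rw [h2]
    exact_mod_cast h1
  · intro I J _ hJY _ hJ hI
    have h1 : (J + J).card ≤ m := (Finset.card_le_card hJ).trans hI
    have h2 : J.card ≤ m := by
      rcases Finset.eq_empty_or_nonempty J with rfl | h
      · simp
      · exact (Finset.card_le_card_add_left h).trans h1
    exact ⟨(J + J, J), Finset.mem_image.2 ⟨J, by simp [hJY, h1, h2], rfl⟩, hJ, Finset.Subset.rfl⟩

lemma hasContainers_of_sq_log_le (hn : 2 ≤ Y.card) (hm : Real.log Y.card ^ 2 ≤ (m : ℝ))
    (hε0 : 0 < ε) (hε1 : ε < 1 / 4) :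
    HasContainers m (m / Real.log Y.card) ε Y ∅ Y ∅
      (Real.exp ((2 : ℝ) ^ 16 * (1 / ε ^ 2) * Real.sqrt m *
        Real.log Y.card ^ ((3 : ℝ) / 2))) := by
  set L := Real.log Y.card with hL
  have hn' : (2 : ℝ) ≤ Y.card := by exact_mod_cast hn
  have hL2 : 1 / 2 ≤ L := by
    have := Real.log_le_log (by norm_num) hn'
    have := Real.log_two_gt_d9
    linarith
  have hL0 : 0 < L := by linarith
  set r := Real.sqrt (m / L) with hr
  have hmL : L ≤ m / L := by rw [le_div_iff₀ hL0]; nlinarith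
  have hr2 : r ^ 2 = m / L := Real.sq_sqrt (by linarith)
  have hrnn : 0 ≤ r := Real.sqrt_nonneg _
  have hrlow : 1 / 2 ≤ r := by nlinarith
  have hmr : (m : ℝ) = r ^ 2 * L := by rw [hr2]; field_simp
  have htarget : Real.sqrt m * L ^ ((3 : ℝ) / 2) = r * L ^ 2 := by
    have h1 : L ^ ((3 : ℝ) / 2) = L * Real.sqrt L := by
      rw [Real.sqrt_eq_rpow, show (3 : ℝ) / 2 = 1 + 1 / 2 by norm_num, Real.rpow_add hL0,
        Real.rpow_one]
    rw [h1, hmr, Real.sqrt_mul (by positivity), Real.sqrt_sq hrnn]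
    have := Real.mul_self_sqrt hL0.le
    linear_combination (r * L) * this
  rw [mul_assoc, htarget]
  have hεsq : ε ^ 2 ≤ 1 / 16 := by nlinarith
  have hεpos : 0 < ε ^ 2 := by positivity
  -- For small ε²r the algorithm may lack room for s ≤ ε²M/4, but the trivial family is already
  -- small enough.
  by_cases hcase : ε ^ 2 * r < 16
  · refine (hasContainers_sumsets hn).mono (Real.exp_le_exp.2 ?_)
    have h1 : r ≤ 16 * (1 / ε ^ 2) := by
      rw [mul_one_div, le_div_iff₀ hεpos]; linarith
    have h2 : 0 ≤ r * L ^ 2 := by positivity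
    rw [hmr]
    calc 2 * (r ^ 2 * L) * L = 2 * r * (r * L ^ 2) := by ring
      _ ≤ 2 * (16 * (1 / ε ^ 2)) * (r * L ^ 2) := by gcongr
      _ ≤ 2 ^ 16 * (1 / ε ^ 2) * (r * L ^ 2) := by
        have : 0 ≤ 1 / ε ^ 2 := by positivity
        gcongr ?_ * _
        linarith
  · push Not at hcase
    have hr256 : 256 ≤ r := by nlinarith
    set s := ⌈r⌉₊ with hs
    have hrs : r ≤ s := Nat.le_ceil r
    have hsr : (s : ℝ) ≤ 2 * r := by
      have := (Nat.ceil_lt_add_one hrnn).le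
      linarith
    have hspos : 0 < s := Nat.ceil_pos.2 (by linarith)
    have hsM : (s : ℝ) ≤ ε ^ 2 / 4 * (m / L) := by
      rw [← hr2]; nlinarith
    obtain ⟨k, hk⟩ := exists_nat_gt (roundPotential m (m / L) (ε ^ 2 / 8) (∅ : Finset G) Y)
    refine (hasContainers_of_roundPotential_lt hn hε0 hε1 (by rw [← hr2]; nlinarith) hspos hsM k
      ∅ Y (by simp) Finset.Subset.rfl hk).mono ?_
    rw [← Real.exp_add]
    refine Real.exp_le_exp.2 ?_
    -- With M = m/L both terms of the potential start at L.
    have hP : roundPotential m (m / L) (ε ^ 2 / 8) (∅ : Finset G) Y = 16 * (1 / ε ^ 2) * L := by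
      have hm0 : (m : ℝ) ≠ 0 := by rw [hmr]; positivity
      unfold roundPotential
      rw [← hL]
      simp only [Finset.card_empty, Nat.cast_zero, sub_zero]
      field_simp
      ring
    have hQ : ((m : ℝ) - (∅ : Finset G).card) / (ε ^ 2 / 8 * s) ≤ 8 * (1 / ε ^ 2) * (r * L) := by
      have hs0 : (0 : ℝ) < s := by exact_mod_cast hspos
      simp only [Finset.card_empty, Nat.cast_zero, sub_zero]
      rw [div_le_iff₀ (by positivity), hmr]
      calc r ^ 2 * L = r * L * r := by ring
        _ ≤ r * L * s := by gcongr
        _ = _ := by field_simp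
    have hi : 0 < 1 / ε ^ 2 := by positivity
    rw [hP]
    calc 3 * (s : ℝ) * L * (16 * (1 / ε ^ 2) * L) +
          2 * L * (((m : ℝ) - (∅ : Finset G).card) / (ε ^ 2 / 8 * s))
        ≤ 3 * (2 * r) * L * (16 * (1 / ε ^ 2) * L) + 2 * L * (8 * (1 / ε ^ 2) * (r * L)) := by
          gcongr
      _ = 112 * ((1 / ε ^ 2) * (r * L ^ 2)) := by ring
      _ ≤ 2 ^ 16 * ((1 / ε ^ 2) * (r * L ^ 2)) := by gcongr; norm_num
      _ = _ := by ring

end Containers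

theorem theorem4p2 {G : Type*} [AddCommGroup G] [DecidableEq G]
    (m n : ℕ) (hn : 2 ≤ n) (hm : (Real.log (n : ℝ)) ^ 2 ≤ (m : ℝ))
    (Y : Finset G) (hY : Y.card = n) (ε : ℝ) (hε0 : 0 < ε) (hε1 : ε < 1 / 4) :
    ∃ 𝒜 : Finset (Finset G × Finset G),
      (∀ A B : Finset G, (A, B) ∈ 𝒜 → A ⊆ Y + Y ∧ B ⊆ Y) ∧
      (𝒜.card : ℝ) ≤
        Real.exp ((2 : ℝ) ^ 16 * (1 / ε ^ 2) * Real.sqrt (m : ℝ) *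
          (Real.log (n : ℝ)) ^ ((3 : ℝ) / 2)) ∧
      (∀ J I : Finset G, J ⊆ Y → I ⊆ Y + Y → J + J ⊆ I → I.card ≤ m →
        ∃ A B : Finset G, (A, B) ∈ 𝒜 ∧ A ⊆ I ∧ J ⊆ B) ∧
      (∀ A B : Finset G, (A, B) ∈ 𝒜 →
        A.card ≤ m ∧
          ((B.card : ℝ) ≤ (m : ℝ) / Real.log (n : ℝ) ∨
            (((B ×ˢ B).filter (fun b => b.1 + b.2 ∉ A)).card : ℝ) ≤
              ε ^ 2 * (B.card : ℝ) ^ 2)) := by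
  subst hY
  obtain ⟨𝒜, hcont, hcard, hcov⟩ := hasContainers_of_sq_log_le hn hm hε0 hε1
  refine ⟨𝒜, fun A B h => ⟨(hcont _ h).1, (hcont _ h).2.1⟩, hcard, ?_, fun A B h => (hcont _ h).2.2⟩
  intro J I hJ _ hJI hI
  obtain ⟨⟨A, B⟩, hmem, hA, hB⟩ := hcov I J (by simp) hJ (by simp) hJI hI
  exact ⟨A, B, hmem, hA, hB⟩
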